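/- Let $n$ be a natural number, let $0\le s<1$ and let $\frac1{2-s}\le q<1$. Let $M_n(\mathbb C)$ be the space of complex $n\times n$ matrices and $M_n^{++}(\mathbb C)$ the cone of positive definite ones. Then the map $$(A,B)\mapsto \operatorname{tr}\big[(B^*A^{-s}B)^q\big]$$ is jointly convex on $M_n^{++}(\mathbb C)\times M_n(\mathbb C)$; that is, for all $A_1,A_2\in M_n^{++}(\mathbb C)$, all $B_1,B_2\in M_n(\mathbb C)$ and all $\lambda\in[0,1]$, with $A=\lambda A_1+(1-\lambda)A_2$ and $B=\lambda B_1+(1-\lambda)B_2$, $$\operatorname{tr}\big[(B^*A^{-s}B)^q\big]\le \lambda\operatorname{tr}\big[(B_1^*A_1^{-s}B_1)^q\big]+(1-\lambda)\operatorname{tr}\big[(B_2^*A_2^{-s}B_2)^q\big].$$ Here real powers of positive semidefinite matrices are taken by the functional calculus on the spectrum. -/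

import Mathlib

-- The Loewner order on matrices; it provides the real powers `A ^ r` of positive
-- semidefinite matrices through the continuous functional calculus (`CFC.rpow`).
open scoped ComplexOrder MatrixOrder Matrix

/-! Write `K = B* A⁻ˢ B` and `r = (1 - s) q / (1 - q)`. Young's inequality makes `tr K^q` the
infimum over positive definite `Z` of `q tr(K Z^(s-1)) + (1 - q) tr Z^r` (`re_trace_rpow_le_young`,
`exists_young_lt`). An infimum over one variable of a jointly convex function is convex in the
others, so joint convexity in `(A, B, Z)` is enough.

The first term is Lieb's functional (`re_trace_rpow_combination_le`): left multiplication by `A` and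
right multiplication by `Z` commute, so `x⁻ˢ y^(s-1)` becomes an integral of resolvents `(x + l
y)⁻¹`, each giving a supremum of functionals linear in `(A, Z, B)`. The second is convex by Klein's
inequality because `r ≥ 1`, which is what `q ≥ 1 / (2 - s)` says. -/

namespace Matrix

variable {ι : Type*} [Fintype ι] [DecidableEq ι] {A Z : Matrix ι ι ℂ}

/-! ### Traces in a pair of eigenbases -/

/-- The double sum `∑ k (aᵢ, zⱼ) |bᵢⱼ|²`, where `aᵢ` and `zⱼ` are the eigenvalues of `A` and `Z`, and
`bᵢⱼ` are the entries of `B` in the corresponding eigenbases. -/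
noncomputable def spectralForm (hA : A.IsHermitian) (hZ : Z.IsHermitian) (k : ℝ → ℝ → ℝ)
    (B : Matrix ι ι ℂ) : ℝ :=
  ∑ i, ∑ j, k (hA.eigenvalues i) (hZ.eigenvalues j) *
    Complex.normSq (((hA.eigenvectorUnitary : Matrix ι ι ℂ)ᴴ * B *
      (hZ.eigenvectorUnitary : Matrix ι ι ℂ)) i j)

theorem IsHermitian.cfc_eq_mul_diagonal (hA : A.IsHermitian) (f : ℝ → ℝ) :
    cfc f A = (hA.eigenvectorUnitary : Matrix ι ι ℂ) *
      diagonal (fun i => (f (hA.eigenvalues i) : ℂ)) *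
      (hA.eigenvectorUnitary : Matrix ι ι ℂ)ᴴ := by
  rw [hA.cfc_eq, IsHermitian.cfc, Unitary.conjStarAlgAut_apply]
  rfl

theorem IsHermitian.conjTranspose_mul_eigenvectorUnitary (hA : A.IsHermitian) :
    (hA.eigenvectorUnitary : Matrix ι ι ℂ)ᴴ * (hA.eigenvectorUnitary : Matrix ι ι ℂ) = 1 :=
  Unitary.coe_star_mul_self hA.eigenvectorUnitary

theorem IsHermitian.eigenvectorUnitary_mul_conjTranspose (hA : A.IsHermitian) :
    (hA.eigenvectorUnitary : Matrix ι ι ℂ) * (hA.eigenvectorUnitary : Matrix ι ι ℂ)ᴴ = 1 :=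
  Unitary.coe_mul_star_self hA.eigenvectorUnitary

theorem re_trace_conjTranspose_mul_diagonal (C : Matrix ι ι ℂ) (d e : ι → ℝ) :
    (trace (Cᴴ * diagonal (fun i => (d i : ℂ)) * C * diagonal (fun i => (e i : ℂ)))).re =
      ∑ i, ∑ j, d i * e j * Complex.normSq (C i j) := by
  simp only [trace, diag_apply, mul_diagonal, mul_apply (N := C), Complex.re_sum, Finset.sum_mul,
    conjTranspose_apply]
  rw [Finset.sum_comm]
  refine Finset.sum_congr rfl fun i _ => Finset.sum_congr rfl fun j _ => ?_
  simp [Complex.normSq_apply]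
  ring

theorem re_trace_cfc_eq_spectralForm (hA : A.IsHermitian) (hZ : Z.IsHermitian) (f g : ℝ → ℝ)
    (B : Matrix ι ι ℂ) :
    (trace (Bᴴ * cfc f A * B * cfc g Z)).re = spectralForm hA hZ (fun x y => f x * g y) B := by
  rw [spectralForm, ← re_trace_conjTranspose_mul_diagonal, hA.cfc_eq_mul_diagonal,
    hZ.cfc_eq_mul_diagonal]
  simp only [conjTranspose_mul, conjTranspose_conjTranspose]
  rw [← Matrix.mul_assoc, trace_mul_comm]
  simp only [Matrix.mul_assoc]

theorem IsHermitian.re_trace_cfc (hA : A.IsHermitian) (f : ℝ → ℝ) :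
    (trace (cfc f A)).re = ∑ i, f (hA.eigenvalues i) := by
  rw [hA.cfc_eq_mul_diagonal, trace_mul_comm, ← Matrix.mul_assoc,
    hA.conjTranspose_mul_eigenvectorUnitary]
  simp [trace]

theorem spectralForm_mono (hA : A.IsHermitian) (hZ : Z.IsHermitian) {k l : ℝ → ℝ → ℝ}
    (h : ∀ i j, k (hA.eigenvalues i) (hZ.eigenvalues j) ≤ l (hA.eigenvalues i) (hZ.eigenvalues j))
    (B : Matrix ι ι ℂ) : spectralForm hA hZ k B ≤ spectralForm hA hZ l B :=
  Finset.sum_le_sum fun i _ => Finset.sum_le_sum fun j _ =>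
    mul_le_mul_of_nonneg_right (h i j) (Complex.normSq_nonneg _)

theorem spectralForm_add (hA : A.IsHermitian) (hZ : Z.IsHermitian) (k l : ℝ → ℝ → ℝ)
    (B : Matrix ι ι ℂ) :
    spectralForm hA hZ (fun x y => k x y + l x y) B =
      spectralForm hA hZ k B + spectralForm hA hZ l B := by
  simp only [spectralForm, add_mul, Finset.sum_add_distrib]

theorem spectralForm_const_mul (hA : A.IsHermitian) (hZ : Z.IsHermitian) (c : ℝ) (k : ℝ → ℝ → ℝ)
    (B : Matrix ι ι ℂ) :
    spectralForm hA hZ (fun x y => c * k x y) B = c * spectralForm hA hZ k B := by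
  simp only [spectralForm, mul_assoc, Finset.mul_sum]

theorem re_trace_conjTranspose_mul_self_mul (hA : A.IsHermitian) (hZ : Z.IsHermitian)
    (B : Matrix ι ι ℂ) :
    (trace (Bᴴ * A * B)).re = spectralForm hA hZ (fun x _ => x) B ∧
      (trace (Bᴴ * B * Z)).re = spectralForm hA hZ (fun _ y => y) B := by
  have h1 := re_trace_cfc_eq_spectralForm hA hZ (fun x => x) (fun _ => 1) B
  have h2 := re_trace_cfc_eq_spectralForm hA hZ (fun _ => 1) (fun x => x) B
  have hA' : IsSelfAdjoint A := hA
  have hZ' : IsSelfAdjoint Z := hZ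
  rw [cfc_id' ℝ A, cfc_const_one ℝ Z] at h1
  rw [cfc_id' ℝ Z, cfc_const_one ℝ A] at h2
  simpa using And.intro h1 h2

/-- With `B = 1` the weights are squared overlaps of eigenvectors; this lets scalar inequalities in
`x, y` pass to traces of noncommuting `A` and `Z`. -/
theorem re_trace_cfc_eq_spectralForm_one (hA : A.IsHermitian) (hZ : Z.IsHermitian) (f : ℝ → ℝ) :
    (trace (cfc f A)).re = spectralForm hA hZ (fun x _ => f x) 1 ∧
      (trace (cfc f Z)).re = spectralForm hA hZ (fun _ y => f y) 1 := by
  have h1 := re_trace_cfc_eq_spectralForm hA hZ f (fun _ => 1) 1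
  have h2 := re_trace_cfc_eq_spectralForm hA hZ (fun _ => 1) f 1
  have hA' : IsSelfAdjoint A := hA
  have hZ' : IsSelfAdjoint Z := hZ
  rw [cfc_const_one ℝ Z] at h1
  rw [cfc_const_one ℝ A] at h2
  simpa using And.intro h1 h2

/-! ### Resolvent forms as suprema -/

/-- The concave quadratic functional `X ↦ 2 Re tr(X* B) - α tr(X* A X) - β tr(X* X Z)`. -/
noncomputable def sylvesterFunctional (α β : ℝ) (A Z B X : Matrix ι ι ℂ) : ℝ :=
  2 * (trace (Xᴴ * B)).re - α * (trace (Xᴴ * A * X)).re - β * (trace (Xᴴ * X * Z)).re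

theorem re_trace_conjTranspose_mul {κ : Type*} [Fintype κ] (X B : Matrix κ κ ℂ) :
    (trace (Xᴴ * B)).re = ∑ i, ∑ j, (star (X i j) * B i j).re := by
  simp only [trace, diag_apply, mul_apply, Complex.re_sum, conjTranspose_apply]
  exact Finset.sum_comm

theorem sylvesterFunctional_eq_sum (hA : A.IsHermitian) (hZ : Z.IsHermitian) (α β : ℝ)
    (B X : Matrix ι ι ℂ) :
    sylvesterFunctional α β A Z B ((hA.eigenvectorUnitary : Matrix ι ι ℂ) * X *
        (hZ.eigenvectorUnitary : Matrix ι ι ℂ)ᴴ) =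
      ∑ i, ∑ j, (2 * (star (X i j) * ((hA.eigenvectorUnitary : Matrix ι ι ℂ)ᴴ * B *
          (hZ.eigenvectorUnitary : Matrix ι ι ℂ)) i j).re -
        (α * hA.eigenvalues i + β * hZ.eigenvalues j) * Complex.normSq (X i j)) := by
  set U := (hA.eigenvectorUnitary : Matrix ι ι ℂ) with hU
  set V := (hZ.eigenvectorUnitary : Matrix ι ι ℂ) with hV
  have hX : Uᴴ * (U * X * Vᴴ) * V = X := by
    calc Uᴴ * (U * X * Vᴴ) * V = (Uᴴ * U) * X * (Vᴴ * V) := by simp only [Matrix.mul_assoc]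
      _ = X := by
        rw [hA.conjTranspose_mul_eigenvectorUnitary, hZ.conjTranspose_mul_eigenvectorUnitary]
        simp
  have hB : trace ((U * X * Vᴴ)ᴴ * B) = trace (Xᴴ * (Uᴴ * B * V)) := by
    simp only [conjTranspose_mul, conjTranspose_conjTranspose]
    rw [Matrix.mul_assoc V, trace_mul_comm]
    simp only [Matrix.mul_assoc]
  obtain ⟨h1, h2⟩ := re_trace_conjTranspose_mul_self_mul hA hZ (U * X * Vᴴ)
  rw [sylvesterFunctional, h1, h2, hB, re_trace_conjTranspose_mul, spectralForm, spectralForm,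
    ← hU, ← hV, hX]
  simp only [Finset.mul_sum, ← Finset.sum_sub_distrib]
  refine Finset.sum_congr rfl fun i _ => Finset.sum_congr rfl fun j _ => ?_
  ring

/-- Complete the square in each entry: `2 Re(x̄ b) - m |x|² ≤ |b|² / m`. -/
theorem sylvesterFunctional_le_spectralForm (hA : A.IsHermitian) (hZ : Z.IsHermitian) {α β : ℝ}
    (h : ∀ i j, 0 < α * hA.eigenvalues i + β * hZ.eigenvalues j) (B X : Matrix ι ι ℂ) :
    sylvesterFunctional α β A Z B X ≤ spectralForm hA hZ (fun x y => (α * x + β * y)⁻¹) B := by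
  have hX : X = (hA.eigenvectorUnitary : Matrix ι ι ℂ) *
      ((hA.eigenvectorUnitary : Matrix ι ι ℂ)ᴴ * X * (hZ.eigenvectorUnitary : Matrix ι ι ℂ)) *
        (hZ.eigenvectorUnitary : Matrix ι ι ℂ)ᴴ := by
    rw [Matrix.mul_assoc, Matrix.mul_assoc, hZ.eigenvectorUnitary_mul_conjTranspose,
      Matrix.mul_one, ← Matrix.mul_assoc, hA.eigenvectorUnitary_mul_conjTranspose, Matrix.one_mul]
  rw [hX, sylvesterFunctional_eq_sum, spectralForm]
  refine Finset.sum_le_sum fun i _ => Finset.sum_le_sum fun j _ => ?_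
  have hm := h i j
  generalize α * hA.eigenvalues i + β * hZ.eigenvalues j = m at hm ⊢
  generalize ((hA.eigenvectorUnitary : Matrix ι ι ℂ)ᴴ * X *
    (hZ.eigenvectorUnitary : Matrix ι ι ℂ)) i j = x
  generalize ((hA.eigenvectorUnitary : Matrix ι ι ℂ)ᴴ * B *
    (hZ.eigenvectorUnitary : Matrix ι ι ℂ)) i j = b
  rw [inv_mul_eq_div, le_div_iff₀ hm]
  simp [Complex.normSq_apply]
  nlinarith [sq_nonneg (m * x.re - b.re), sq_nonneg (m * x.im - b.im)]

/-- The maximiser solves the Sylvester equation `α A X + β X Z = B`, which is diagonal in the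
eigenbases. -/
theorem exists_sylvesterFunctional_eq_spectralForm (hA : A.IsHermitian) (hZ : Z.IsHermitian)
    {α β : ℝ} (h : ∀ i j, 0 < α * hA.eigenvalues i + β * hZ.eigenvalues j) (B : Matrix ι ι ℂ) :
    ∃ X, sylvesterFunctional α β A Z B X =
      spectralForm hA hZ (fun x y => (α * x + β * y)⁻¹) B := by
  refine ⟨_, (sylvesterFunctional_eq_sum hA hZ α β B (Matrix.of fun i j =>
    ((α * hA.eigenvalues i + β * hZ.eigenvalues j : ℝ)⁻¹ : ℂ) *
      ((hA.eigenvectorUnitary : Matrix ι ι ℂ)ᴴ * B *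
        (hZ.eigenvectorUnitary : Matrix ι ι ℂ)) i j)).trans ?_⟩
  refine Finset.sum_congr rfl fun i _ => Finset.sum_congr rfl fun j _ => ?_
  have hm := (h i j).ne'
  simp only [of_apply, ← Complex.ofReal_inv]
  generalize α * hA.eigenvalues i + β * hZ.eigenvalues j = m at hm ⊢
  generalize ((hA.eigenvectorUnitary : Matrix ι ι ℂ)ᴴ * B *
    (hZ.eigenvectorUnitary : Matrix ι ι ℂ)) i j = b
  simp [Complex.normSq_apply, -Complex.ofReal_inv]
  field_simp
  ring

theorem sylvesterFunctional_combination {κ : Type*} [Fintype κ] (α β a b : ℝ)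
    (A₁ A₂ Z₁ Z₂ B₁ B₂ X : Matrix κ κ ℂ) :
    sylvesterFunctional α β (a • A₁ + b • A₂) (a • Z₁ + b • Z₂) (a • B₁ + b • B₂) X =
      a * sylvesterFunctional α β A₁ Z₁ B₁ X + b * sylvesterFunctional α β A₂ Z₂ B₂ X := by
  simp only [sylvesterFunctional, Matrix.mul_add, Matrix.add_mul, Matrix.mul_smul, Matrix.smul_mul,
    trace_add, trace_smul, Complex.add_re, Complex.smul_re, smul_eq_mul]
  ring

theorem PosDef.combination {κ : Type*} {A₁ A₂ : Matrix κ κ ℂ} (h₁ : A₁.PosDef)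
    (h₂ : A₂.PosDef) {a b : ℝ} (ha : 0 ≤ a) (hb : 0 ≤ b) (hab : a + b = 1) :
    (a • A₁ + b • A₂).PosDef := by
  rcases ha.eq_or_lt with rfl | ha
  · obtain rfl : b = 1 := by linarith
    simpa using h₂
  rcases hb.eq_or_lt with rfl | hb
  · obtain rfl : a = 1 := by linarith
    simpa using h₁
  exact (h₁.smul ha).add (h₂.smul hb)

/-- Joint convexity of `(A, Z, B) ↦ ⟨B, (α L_A + β R_Z)⁻¹ B⟩`. -/
theorem spectralForm_inv_combination_le {A₁ A₂ Z₁ Z₂ : Matrix ι ι ℂ} (hA₁ : A₁.PosDef)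
    (hA₂ : A₂.PosDef) (hZ₁ : Z₁.PosDef) (hZ₂ : Z₂.PosDef) {a b : ℝ} (ha : 0 ≤ a) (hb : 0 ≤ b)
    (hA : (a • A₁ + b • A₂).PosDef) (hZ : (a • Z₁ + b • Z₂).PosDef) {α β : ℝ} (hα : 0 ≤ α)
    (hβ : 0 < β) (B₁ B₂ : Matrix ι ι ℂ) :
    spectralForm hA.isHermitian hZ.isHermitian (fun x y => (α * x + β * y)⁻¹) (a • B₁ + b • B₂) ≤
      a * spectralForm hA₁.isHermitian hZ₁.isHermitian (fun x y => (α * x + β * y)⁻¹) B₁ +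
      b * spectralForm hA₂.isHermitian hZ₂.isHermitian (fun x y => (α * x + β * y)⁻¹) B₂ := by
  have key {A Z : Matrix ι ι ℂ} (hA : A.PosDef) (hZ : Z.PosDef) (i j : ι) :
      0 < α * hA.isHermitian.eigenvalues i + β * hZ.isHermitian.eigenvalues j :=
    add_pos_of_nonneg_of_pos (mul_nonneg hα (hA.eigenvalues_pos i).le)
      (mul_pos hβ (hZ.eigenvalues_pos j))
  -- The maximiser for the combination serves as a trial point at both endpoints.
  obtain ⟨X, hX⟩ := exists_sylvesterFunctional_eq_spectralForm hA.isHermitian hZ.isHermitian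
    (key hA hZ) (a • B₁ + b • B₂)
  rw [← hX, sylvesterFunctional_combination]
  exact add_le_add
    (mul_le_mul_of_nonneg_left (sylvesterFunctional_le_spectralForm _ _ (key hA₁ hZ₁) _ _) ha)
    (mul_le_mul_of_nonneg_left (sylvesterFunctional_le_spectralForm _ _ (key hA₂ hZ₂) _ _) hb)

/-! ### Lieb's joint convexity by integrating resolvents -/

open MeasureTheory Set in
-- By homogeneity this is the integral formula for `t^(1-s)` at `t = x / y`, divided by `x`.
theorem integral_rpow_mul_inv_add {s x y : ℝ} (hs : s ∈ Ioo (0 : ℝ) 1) (hx : 0 < x) (hy : 0 < y) :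
    IntegrableOn (fun l : ℝ => l ^ (-s) * (x + l * y)⁻¹) (Ioi 0) ∧
      ∫ l in Ioi (0 : ℝ), l ^ (-s) * (x + l * y)⁻¹ =
        (∫ l in Ioi (0 : ℝ), Real.rpowIntegrand₀₁ (1 - s) l 1) * (x ^ (-s) * y ^ (s - 1)) := by
  have hp : 1 - s ∈ Ioo (0 : ℝ) 1 := ⟨by linarith [hs.2], by linarith [hs.1]⟩
  have hxy : 0 ≤ x / y := (div_pos hx hy).le
  have heq : EqOn (fun l : ℝ => x⁻¹ * Real.rpowIntegrand₀₁ (1 - s) l (x / y))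
      (fun l => l ^ (-s) * (x + l * y)⁻¹) (Ioi 0) := by
    intro l hl
    have hl' : 0 < l := hl
    simp only
    rw [Real.rpowIntegrand₀₁_eq_pow_div hp hl'.le hxy, show 1 - s - 1 = -s by ring]
    have h1 : x + l * y ≠ 0 := by positivity
    have h2 : l + x / y ≠ 0 := by positivity
    have h3 : l * y + x ≠ 0 := by positivity
    field_simp
    ring
  constructor
  · exact (integrableOn_congr_fun heq measurableSet_Ioi).1
      ((Real.integrableOn_rpowIntegrand₀₁_Ioi hp hxy).const_mul x⁻¹)
  · rw [← setIntegral_congr_fun measurableSet_Ioi heq, integral_const_mul,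
      Real.integral_rpowIntegrand₀₁_eq_rpow_mul_const hp hxy, Real.div_rpow hx.le hy.le,
      Real.rpow_sub hx, Real.rpow_neg hx.le, Real.rpow_sub hy, Real.rpow_sub hy, Real.rpow_one,
      Real.rpow_one]
    field_simp

open MeasureTheory Set in
theorem spectralForm_rpow_eq_integral (hA : A.PosDef) (hZ : Z.PosDef) {s : ℝ}
    (hs : s ∈ Ioo (0 : ℝ) 1) (B : Matrix ι ι ℂ) :
    IntegrableOn (fun l : ℝ => l ^ (-s) *
        spectralForm hA.isHermitian hZ.isHermitian (fun x y => (1 * x + l * y)⁻¹) B) (Ioi 0) ∧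
      ∫ l in Ioi (0 : ℝ), l ^ (-s) *
        spectralForm hA.isHermitian hZ.isHermitian (fun x y => (1 * x + l * y)⁻¹) B =
      (∫ l in Ioi (0 : ℝ), Real.rpowIntegrand₀₁ (1 - s) l 1) *
        spectralForm hA.isHermitian hZ.isHermitian (fun x y => x ^ (-s) * y ^ (s - 1)) B := by
  simp only [spectralForm, Finset.mul_sum, ← mul_assoc, one_mul]
  have key (i j : ι) := integral_rpow_mul_inv_add hs (hA.eigenvalues_pos i) (hZ.eigenvalues_pos j)
  constructor
  · exact integrable_finsetSum _ fun i _ => integrable_finsetSum _ fun j _ =>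
      (key i j).1.mul_const _
  · rw [integral_finsetSum _ fun i _ => integrable_finsetSum _ fun j _ => (key i j).1.mul_const _]
    refine Finset.sum_congr rfl fun i _ => ?_
    rw [integral_finsetSum _ fun j _ => (key i j).1.mul_const _]
    refine Finset.sum_congr rfl fun j _ => ?_
    rw [integral_mul_const, (key i j).2]
    ring

open MeasureTheory Set in
/-- Joint convexity of `(A, Z, B) ↦ tr(B* A⁻ˢ B Zˢ⁻¹)`, in spectral form. -/
theorem spectralForm_rpow_combination_le {A₁ A₂ Z₁ Z₂ : Matrix ι ι ℂ} (hA₁ : A₁.PosDef)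
    (hA₂ : A₂.PosDef) (hZ₁ : Z₁.PosDef) (hZ₂ : Z₂.PosDef) {a b : ℝ} (ha : 0 ≤ a) (hb : 0 ≤ b)
    (hA : (a • A₁ + b • A₂).PosDef) (hZ : (a • Z₁ + b • Z₂).PosDef) {s : ℝ} (hs0 : 0 ≤ s)
    (hs1 : s < 1) (B₁ B₂ : Matrix ι ι ℂ) :
    spectralForm hA.isHermitian hZ.isHermitian (fun x y => x ^ (-s) * y ^ (s - 1))
        (a • B₁ + b • B₂) ≤
      a * spectralForm hA₁.isHermitian hZ₁.isHermitian (fun x y => x ^ (-s) * y ^ (s - 1)) B₁ +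
      b * spectralForm hA₂.isHermitian hZ₂.isHermitian (fun x y => x ^ (-s) * y ^ (s - 1)) B₂ := by
  rcases hs0.eq_or_lt with rfl | hs0
  -- At `s = 0` the integral diverges, but the kernel is `y⁻¹`, the resolvent with `α = 0`, `β = 1`.
  · simpa [Real.rpow_neg_one] using
      spectralForm_inv_combination_le hA₁ hA₂ hZ₁ hZ₂ ha hb hA hZ le_rfl one_pos B₁ B₂
  have hs : s ∈ Ioo (0 : ℝ) 1 := ⟨hs0, hs1⟩
  have hC := Real.integral_rpowIntegrand₀₁_one_pos (p := 1 - s) ⟨by linarith, by linarith⟩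
  obtain ⟨i, e⟩ := spectralForm_rpow_eq_integral hA hZ hs (a • B₁ + b • B₂)
  obtain ⟨i₁, e₁⟩ := spectralForm_rpow_eq_integral hA₁ hZ₁ hs B₁
  obtain ⟨i₂, e₂⟩ := spectralForm_rpow_eq_integral hA₂ hZ₂ hs B₂
  refine le_of_mul_le_mul_left ?_ hC
  rw [mul_add, mul_left_comm, mul_left_comm _ b, ← e, ← e₁, ← e₂, ← integral_const_mul,
    ← integral_const_mul, ← integral_add (i₁.const_mul a) (i₂.const_mul b)]
  refine setIntegral_mono_on i ((i₁.const_mul a).add (i₂.const_mul b)) measurableSet_Ioi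
    fun l hl => ?_
  have h := mul_le_mul_of_nonneg_left (spectralForm_inv_combination_le hA₁ hA₂ hZ₁ hZ₂ ha hb hA hZ
    zero_le_one (mem_Ioi.1 hl) B₁ B₂) (Real.rpow_nonneg (mem_Ioi.1 hl).le (-s))
  refine h.trans (le_of_eq ?_)
  ring

theorem PosSemidef.rpow_eq_cfc (hA : A.PosSemidef) (y : ℝ) :
    A ^ y = cfc (fun x : ℝ => x ^ y) A :=
  CFC.rpow_eq_cfc_real hA.nonneg

/-- Joint convexity of `(A, Z, B) ↦ tr(B* A⁻ˢ B Zˢ⁻¹)`. -/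
theorem re_trace_rpow_combination_le {A₁ A₂ Z₁ Z₂ : Matrix ι ι ℂ} (hA₁ : A₁.PosDef)
    (hA₂ : A₂.PosDef) (hZ₁ : Z₁.PosDef) (hZ₂ : Z₂.PosDef) {a b : ℝ} (ha : 0 ≤ a) (hb : 0 ≤ b)
    (hab : a + b = 1) {s : ℝ} (hs0 : 0 ≤ s) (hs1 : s < 1) (B₁ B₂ : Matrix ι ι ℂ) :
    (trace ((a • B₁ + b • B₂)ᴴ * (a • A₁ + b • A₂) ^ (-s) * (a • B₁ + b • B₂) *
        (a • Z₁ + b • Z₂) ^ (s - 1))).re ≤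
      a * (trace (B₁ᴴ * A₁ ^ (-s) * B₁ * Z₁ ^ (s - 1))).re +
      b * (trace (B₂ᴴ * A₂ ^ (-s) * B₂ * Z₂ ^ (s - 1))).re := by
  have hA := hA₁.combination hA₂ ha hb hab
  have hZ := hZ₁.combination hZ₂ ha hb hab
  have key {A Z : Matrix ι ι ℂ} (hA : A.PosDef) (hZ : Z.PosDef) (B : Matrix ι ι ℂ) :
      (trace (Bᴴ * A ^ (-s) * B * Z ^ (s - 1))).re =
        spectralForm hA.isHermitian hZ.isHermitian (fun x y => x ^ (-s) * y ^ (s - 1)) B := by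
    rw [hA.posSemidef.rpow_eq_cfc, hZ.posSemidef.rpow_eq_cfc, re_trace_cfc_eq_spectralForm]
  rw [key hA hZ, key hA₁ hZ₁, key hA₂ hZ₂]
  exact spectralForm_rpow_combination_le hA₁ hA₂ hZ₁ hZ₂ ha hb hA hZ hs0 hs1 B₁ B₂

/-! ### Klein's inequality and convexity of the trace power -/

/-- The tangent line at `y` lies below the convex power; this is Bernoulli's inequality at `x / y -
1`. -/
theorem rpow_add_mul_rpow_le {r x y : ℝ} (hr : 1 ≤ r) (hx : 0 < x) (hy : 0 < y) :
    (1 - r) * y ^ r + r * (x * y ^ (r - 1)) ≤ x ^ r := by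
  have h := one_add_mul_self_le_rpow_one_add (s := x / y - 1) (by linarith [div_pos hx hy]) hr
  rw [add_sub_cancel, Real.div_rpow hx.le hy.le, le_div_iff₀ (Real.rpow_pos_of_pos hy r)] at h
  rw [Real.rpow_sub hy, Real.rpow_one]
  refine le_trans (le_of_eq ?_) h
  field_simp
  ring

/-- Klein's inequality for the power function. -/
theorem PosDef.klein_rpow (hA : A.PosDef) (hZ : Z.PosDef) {r : ℝ} (hr : 1 ≤ r) :
    (1 - r) * (trace (Z ^ r)).re + r * (trace (A * Z ^ (r - 1))).re ≤ (trace (A ^ r)).re := by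
  have hA' : IsSelfAdjoint A := hA.isHermitian
  have h := re_trace_cfc_eq_spectralForm hA.isHermitian hZ.isHermitian (fun x => x)
    (fun x => x ^ (r - 1)) 1
  rw [cfc_id' ℝ A, conjTranspose_one, Matrix.one_mul, Matrix.mul_one] at h
  rw [hA.posSemidef.rpow_eq_cfc, hZ.posSemidef.rpow_eq_cfc, hZ.posSemidef.rpow_eq_cfc, h,
    (re_trace_cfc_eq_spectralForm_one hA.isHermitian hZ.isHermitian _).1,
    (re_trace_cfc_eq_spectralForm_one hA.isHermitian hZ.isHermitian _).2,
    ← spectralForm_const_mul, ← spectralForm_const_mul, ← spectralForm_add]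
  exact spectralForm_mono _ _ (fun i j =>
    rpow_add_mul_rpow_le hr (hA.eigenvalues_pos i) (hZ.eigenvalues_pos j)) _

theorem re_trace_rpow_convex {Z₁ Z₂ : Matrix ι ι ℂ} (hZ₁ : Z₁.PosDef) (hZ₂ : Z₂.PosDef) {a b : ℝ}
    (ha : 0 ≤ a) (hb : 0 ≤ b) (hab : a + b = 1) {r : ℝ} (hr : 1 ≤ r) :
    (trace ((a • Z₁ + b • Z₂) ^ r)).re ≤
      a * (trace (Z₁ ^ r)).re + b * (trace (Z₂ ^ r)).re := by
  have hZ := hZ₁.combination hZ₂ ha hb hab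
  -- Both tangents are taken at the combination, so their weighted sum is its own trace power.
  have h₁ := mul_le_mul_of_nonneg_left (hZ₁.klein_rpow hZ hr) ha
  have h₂ := mul_le_mul_of_nonneg_left (hZ₂.klein_rpow hZ hr) hb
  have hself : (trace ((a • Z₁ + b • Z₂) * (a • Z₁ + b • Z₂) ^ (r - 1))).re =
      (trace ((a • Z₁ + b • Z₂) ^ r)).re := by
    generalize a • Z₁ + b • Z₂ = Z at hZ
    have h := CFC.rpow_add (a := Z) (x := 1) (y := r - 1) hZ.isUnit
    rw [add_sub_cancel, CFC.rpow_one Z hZ.posSemidef.nonneg] at h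
    rw [h]
  have hlin : (trace ((a • Z₁ + b • Z₂) * (a • Z₁ + b • Z₂) ^ (r - 1))).re =
      a * (trace (Z₁ * (a • Z₁ + b • Z₂) ^ (r - 1))).re +
      b * (trace (Z₂ * (a • Z₁ + b • Z₂) ^ (r - 1))).re := by
    generalize (a • Z₁ + b • Z₂) ^ (r - 1) = K
    simp [Matrix.add_mul]
  rw [hself] at hlin
  set T := (trace ((a • Z₁ + b • Z₂) ^ r)).re
  have h3 : a * ((1 - r) * T) + b * ((1 - r) * T) = (1 - r) * T := by
    rw [← add_mul, hab, one_mul]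
  nlinarith

/-! ### The variational formula -/

theorem rpow_le_young {q t x y : ℝ} (hq0 : 0 < q) (hq1 : q < 1) (hx : 0 ≤ x) (hy : 0 < y) :
    x ^ q ≤ q * (x * y ^ (-t)) + (1 - q) * y ^ (t * q / (1 - q)) := by
  have h := Real.geom_mean_le_arith_mean2_weighted hq0.le (sub_nonneg.2 hq1.le)
    (mul_nonneg hx (Real.rpow_nonneg hy.le (-t))) (Real.rpow_nonneg hy.le (t * q / (1 - q)))
    (by ring)
  have hq : 1 - q ≠ 0 := by linarith
  rwa [Real.mul_rpow hx (Real.rpow_nonneg hy.le _), ← Real.rpow_mul hy.le, ← Real.rpow_mul hy.le,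
    mul_assoc, ← Real.rpow_add hy, div_mul_cancel₀ _ hq, neg_mul, neg_add_cancel, Real.rpow_zero,
    mul_one] at h

theorem PosSemidef.re_trace_rpow_le_young (hA : A.PosSemidef) (hZ : Z.PosDef) {q : ℝ} (t : ℝ)
    (hq0 : 0 < q) (hq1 : q < 1) :
    (trace (A ^ q)).re ≤
      q * (trace (A * Z ^ (-t))).re + (1 - q) * (trace (Z ^ (t * q / (1 - q)))).re := by
  have hA' : IsSelfAdjoint A := hA.isHermitian
  have h := re_trace_cfc_eq_spectralForm hA.isHermitian hZ.isHermitian (fun x => x)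
    (fun x => x ^ (-t)) 1
  rw [cfc_id' ℝ A, conjTranspose_one, Matrix.one_mul, Matrix.mul_one] at h
  rw [hA.rpow_eq_cfc, hZ.posSemidef.rpow_eq_cfc, hZ.posSemidef.rpow_eq_cfc, h,
    (re_trace_cfc_eq_spectralForm_one hA.isHermitian hZ.isHermitian _).1,
    (re_trace_cfc_eq_spectralForm_one hA.isHermitian hZ.isHermitian _).2,
    ← spectralForm_const_mul, ← spectralForm_const_mul, ← spectralForm_add]
  exact spectralForm_mono _ _ (fun i j =>
    rpow_le_young hq0 hq1 (hA.eigenvalues_nonneg i) (hZ.eigenvalues_pos j)) _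

/-- Equality in Young's inequality needs `Z = A^((1-q)/t)`, which is not positive definite for
singular `A`; shifting `A` by `ε` costs at most `tr (A + ε)^q - tr A^q`. -/
theorem PosSemidef.exists_young_lt (hA : A.PosSemidef) {q t : ℝ} (hq0 : 0 < q) (hq1 : q < 1)
    (ht : 0 < t) {δ : ℝ} (hδ : 0 < δ) :
    ∃ Z : Matrix ι ι ℂ, Z.PosDef ∧
      q * (trace (A * Z ^ (-t))).re + (1 - q) * (trace (Z ^ (t * q / (1 - q)))).re <
        (trace (A ^ q)).re + δ := by
  have hsa : IsSelfAdjoint A := hA.isHermitian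
  have hcont (f : ℝ → ℝ) : ContinuousOn f (spectrum ℝ A) :=
    (finite_real_spectrum (A := A)).continuousOn f
  have hspec : ∀ x ∈ spectrum ℝ A, 0 ≤ x := fun x hx => spectrum_nonneg_of_nonneg hA.nonneg hx
  have hlim : Filter.Tendsto (fun ε : ℝ => ∑ i, (hA.isHermitian.eigenvalues i + ε) ^ q)
      (nhdsWithin 0 (Set.Ioi 0)) (nhds (∑ i, hA.isHermitian.eigenvalues i ^ q)) := by
    have : Continuous fun ε : ℝ => ∑ i, (hA.isHermitian.eigenvalues i + ε) ^ q :=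
      continuous_finsetSum _ fun i _ =>
        (continuous_const.add continuous_id).rpow_const fun _ => Or.inr hq0.le
    have h := this.tendsto 0
    simp only [add_zero] at h
    exact h.mono_left nhdsWithin_le_nhds
  obtain ⟨ε, hε, hε0⟩ := ((hlim.eventually_lt_const (lt_add_of_pos_right _ hδ)).and
    self_mem_nhdsWithin).exists
  replace hε0 : 0 < ε := hε0
  set g : ℝ → ℝ := fun x => (x + ε) ^ ((1 - q) / t) with hg
  have hgpos : ∀ x ∈ spectrum ℝ A, 0 < g x := fun x hx =>
    Real.rpow_pos_of_pos (add_pos_of_nonneg_of_pos (hspec x hx) hε0) _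
  have hZ : (cfc g A).PosDef := by
    rw [← isStrictlyPositive_iff_posDef]
    exact (cfc_isStrictlyPositive_iff g A (hcont g)).2 hgpos
  have hpow (y : ℝ) : cfc g A ^ y = cfc (fun x => (x + ε) ^ ((1 - q) / t * y)) A := by
    rw [hZ.posSemidef.rpow_eq_cfc, ← cfc_comp' (fun x : ℝ => x ^ y) g A
      (((finite_real_spectrum (A := A)).image g).continuousOn _) (hcont g)]
    refine cfc_congr fun x hx => ?_
    simp only [hg]
    rw [Real.rpow_mul (add_pos_of_nonneg_of_pos (hspec x hx) hε0).le]
  have hq : 1 - q ≠ 0 := by linarith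
  have hmul : A * cfc g A ^ (-t) = cfc (fun x => x * (x + ε) ^ (q - 1)) A := by
    rw [hpow, cfc_mul (fun x => x) _ A (hcont _) (hcont _), cfc_id' ℝ A]
    congr! 4
    field_simp
    ring
  refine ⟨cfc g A, hZ, ?_⟩
  rw [hA.rpow_eq_cfc q, hA.isHermitian.re_trace_cfc]
  refine lt_of_le_of_lt ?_ hε
  rw [hmul, hpow, hA.isHermitian.re_trace_cfc, hA.isHermitian.re_trace_cfc, Finset.mul_sum,
    Finset.mul_sum, ← Finset.sum_add_distrib]
  refine Finset.sum_le_sum fun i _ => ?_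
  have hx := hA.eigenvalues_nonneg i
  generalize hA.isHermitian.eigenvalues i = x at hx ⊢
  have hxε : 0 < x + ε := by linarith
  have he : (1 - q) / t * (t * q / (1 - q)) = q := by field_simp
  have hle : x * (x + ε) ^ (q - 1) ≤ (x + ε) ^ q := by
    calc x * (x + ε) ^ (q - 1) ≤ (x + ε) * (x + ε) ^ (q - 1) :=
          mul_le_mul_of_nonneg_right (by linarith) (Real.rpow_nonneg hxε.le _)
      _ = (x + ε) ^ q := by rw [Real.rpow_sub_one hxε.ne']; field_simp
  rw [he]
  nlinarith

theorem posSemidef_conjTranspose_mul_rpow_mul (A : Matrix ι ι ℂ) (s : ℝ) (B : Matrix ι ι ℂ) :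
    (Bᴴ * A ^ s * B).PosSemidef :=
  (nonneg_iff_posSemidef.1 CFC.rpow_nonneg : (A ^ s).PosSemidef).conjTranspose_mul_mul_same B

end Matrix

open Matrix in
/-- For `0 ≤ s < 1` and `1 / (2 - s) ≤ q < 1`, the map `(A, B) ↦ tr[(B* A^{-s} B)^q]` is jointly
convex on positive definite matrices times all matrices. The trace is that of a positive
semidefinite matrix, hence real; `.re` only moves it from `ℂ` to `ℝ`. -/
theorem corollary4p5 (n : ℕ) (s q : ℝ) (hs0 : 0 ≤ s) (hs1 : s < 1)
    (hq0 : 1 / (2 - s) ≤ q) (hq1 : q < 1) :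
    ConvexOn ℝ
      ({A : Matrix (Fin n) (Fin n) ℂ | A.PosDef} ×ˢ (Set.univ : Set (Matrix (Fin n) (Fin n) ℂ)))
      (fun p : Matrix (Fin n) (Fin n) ℂ × Matrix (Fin n) (Fin n) ℂ =>
        (Matrix.trace ((p.2ᴴ * p.1 ^ (-s) * p.2) ^ q)).re) := by
  have hs2 : 0 < 2 - s := by linarith
  have hq : 0 < q := lt_of_lt_of_le (by positivity) hq0
  -- After clearing denominators, this is `1 ≤ q (2 - s)`.
  have hr : 1 ≤ (1 - s) * q / (1 - q) := by
    rw [le_div_iff₀ (by linarith)]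
    rw [div_le_iff₀ hs2] at hq0
    linarith
  refine ⟨fun x hx y hy a b ha hb hab =>
    ⟨PosDef.combination hx.1 hy.1 ha hb hab, Set.mem_univ _⟩, ?_⟩
  rintro ⟨A₁, B₁⟩ ⟨hA₁, -⟩ ⟨A₂, B₂⟩ ⟨hA₂, -⟩ a b ha hb hab
  simp only [Set.mem_ofPred_eq] at hA₁ hA₂
  simp only [Prod.smul_mk, Prod.mk_add_mk, smul_eq_mul]
  -- The infimum over `Z` need not be attained, so near-minimisers are combined.
  refine le_of_forall_pos_le_add fun δ hδ => ?_
  obtain ⟨Z₁, hZ₁, h₁⟩ := (posSemidef_conjTranspose_mul_rpow_mul A₁ (-s) B₁).exists_young_lt hq hq1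
    (t := 1 - s) (by linarith) hδ
  obtain ⟨Z₂, hZ₂, h₂⟩ := (posSemidef_conjTranspose_mul_rpow_mul A₂ (-s) B₂).exists_young_lt hq hq1
    (t := 1 - s) (by linarith) hδ
  have h := (posSemidef_conjTranspose_mul_rpow_mul (a • A₁ + b • A₂) (-s)
    (a • B₁ + b • B₂)).re_trace_rpow_le_young (hZ₁.combination hZ₂ ha hb hab) (1 - s) hq hq1
  rw [neg_sub] at h h₁ h₂
  have hL := mul_le_mul_of_nonneg_left
    (re_trace_rpow_combination_le hA₁ hA₂ hZ₁ hZ₂ ha hb hab hs0 hs1 B₁ B₂) hq.le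
  have hK := mul_le_mul_of_nonneg_left (re_trace_rpow_convex hZ₁ hZ₂ ha hb hab hr)
    (sub_nonneg.2 hq1.le)
  have h₁' := mul_le_mul_of_nonneg_left h₁.le ha
  have h₂' := mul_le_mul_of_nonneg_left h₂.le hb
  have hδ' : a * δ + b * δ = δ := by rw [← add_mul, hab, one_mul]
  linarith
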